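/- Let $m\ge 2$ and let $t_1,\dots,t_m\in\mathbb N=\{0,1,2,\dots\}$ satisfy $t_1\ge 1$, $t_m\ge 1$ and $t_it_{i+1}\cdots t_m0^\omega\prec_{\mathrm{lex}}t_1t_2\cdots t_m0^\omega$ for every $i\in\{2,\dots,m\}$. Let $\mathbf u$ be the associated simple Parry sequence, i.e. a fixed point $\varphi(\mathbf u)=\mathbf u$ of the morphism $\varphi$ on $\{0,\dots,m-1\}^*$ given by $\varphi(a)=0^{t_{a+1}}(a+1)$ for $0\le a\le m-2$ and $\varphi(m-1)=0^{t_m}$. An attractor of a finite word $w=w_0\cdots w_{\ell-1}$ is a set $\Gamma\subseteq\{0,\dots,\ell-1\}$ such that every non-empty factor of $w$ has an occurrence in $w$ containing a position from $\Gamma$; it is minimal if no attractor of $w$ has fewer elements. Put $u_n=\varphi^n(0)$ and $U_n=|u_n|$ for $n\ge 0$, and $u_n=\varepsilon$ for $n<0$. For $n\ge0$ let $\Gamma_n=\{U_i-1 : \max(0,n-m+1)\le i\le n\}$. For $n\ge m$ let $$z_n=u_nu_{n-m}^{t_1-t_m}u_{n-m-1}^{t_2}\cdots u_{n-2m+1}^{t_m},\qquad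 s_n=u_nu_{n-m}^{t_1-t_m+1}u_{n-m-1}^{t_2}\cdots u_{n-2m+1}^{t_m},$$ $Z_n=|z_n|$ and $S_n=|s_n|$. Let $k=\min\{j\in\{1,\dots,m-1\} : t_{m-j}\ne0\}$. For $j\geq 1$ let $\hat u_j=u_j$ if $j\ge m$, and let $\hat u_j$ be $u_j$ without its last letter if $j<m$. Theorem. Every prefix of $\mathbf u$ has an attractor whose size is the number of distinct letters in the prefix; such an attractor is minimal. Explicitly, each of the following sets is an attractor of the indicated prefix, its size equals the number of distinct letters of the prefix, and it is therefore minimal. 1. For $0\le n\le m-1$, the prefix of length $\ell\in[U_n,U_{n+1}-1]$ has the attractor $\Gamma_n$. 2. The prefix $u_m$ (of length $U_m$) has the attractor $\Gamma_{m-1}$. 3. Let $n\ge m$. If $t_1>t_m$, every prefix of length $\ell\in[Z_n,U_{n+1}]$ has the attractor $\Gamma_n$. If $t_1=t_m$, every prefix of length $\ell\in[Z_n,S_n]$ has the attractor $(\Gamma_{n-1}\setminus\{U_{n-m}-1\})\cup\{U_n-(t_m-1)U_{n-m}-1\}$, and every prefix of length $\ell\in[S_n,U_{n+1}]$ has the attractor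 $\Gamma_n$. 4. Let $n\ge m$. Every prefix $u$ of length $\ell\in[U_n,Z_n]$ has the form $u=u_nx$ and falls in at least one of the following two categories. - (a) $u_{n-m+k}u_{n-m}^{t_m}x$ is a prefix of $u_{n-m+k+1}$. In this case $u$ has the attractor $(\Gamma_{n-1}\setminus\{U_{n-m}-1\})\cup\{U_n-U_{n-m+k}-(t_m-1)U_{n-m}-1\}$. - (b) $u_{n-m+k}u_{n-m}^{t_m}x$ has the prefix $\hat u_{n-m+k+1}$ (in particular, this holds if it has the prefix $u_{n-m+k+1}$). In this case $u$ has the attractor $(\Gamma_{n-1}\setminus\{U_{n-m+k}-1\})\cup\{U_n-t_mU_{n-m}-1\}$. -/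

import Mathlib

namespace SimpleParry

/-- `Γ` is a (string) attractor of the finite word `w`: a set of positions of `w` such that every
non-empty factor of `w` has an occurrence in `w` containing an element of `Γ`. -/
def IsAttractor {α : Type*} (w : List α) (Γ : Finset ℕ) : Prop :=
  (∀ p ∈ Γ, p < w.length) ∧
    ∀ f : List α, f ≠ [] → f <:+: w →
      ∃ x y : List α, w = x ++ f ++ y ∧ ∃ p ∈ Γ, x.length ≤ p ∧ p < x.length + f.length

/-- An attractor of `w` with the minimal number of elements. -/
def IsMinimalAttractor {α : Type*} (w : List α) (Γ : Finset ℕ) : Prop :=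
  IsAttractor w Γ ∧ ∀ Γ' : Finset ℕ, IsAttractor w Γ' → Γ.card ≤ Γ'.card

/-- `Γ` is a minimal attractor of `w`, and its size is the number of distinct letters of `w`. -/
def IsLetterSizeAttractor {α : Type*} [DecidableEq α] (w : List α) (Γ : Finset ℕ) : Prop :=
  IsMinimalAttractor w Γ ∧ Γ.card = w.toFinset.card

/-- The prefix of length `l` of a sequence. -/
def pref {α : Type*} (u : ℕ → α) (l : ℕ) : List α := (List.range l).map u

/-- `v` is the image of the sequence `u` under the morphism `φ`, that is,
`v = φ(u₀) φ(u₁) φ(u₂) ⋯`: the images of the prefixes of `u` are prefixes of `v` of unbounded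
length. -/
def IsImage {α β : Type*} (φ : List α → List β) (u : ℕ → α) (v : ℕ → β) : Prop :=
  (∀ N : ℕ, φ (pref u N) = pref v (φ (pref u N)).length) ∧
    ∀ L : ℕ, ∃ N : ℕ, L ≤ (φ (pref u N)).length

/-- `φ(u) = u` for a sequence `u`. -/
def IsFixedPoint {α : Type*} (φ : List α → List α) (u : ℕ → α) : Prop := IsImage φ u u

/-- The `k`-th power of a finite word. -/
def wpow {α : Type*} (w : List α) (k : ℕ) : List α := (List.replicate k w).flatten

/-- The infinite sequence `tᵢ tᵢ₊₁ ⋯ tₘ 0 0 0 ⋯`. -/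
def tail (m : ℕ) (t : ℕ → ℕ) (i : ℕ) : ℕ → ℕ := fun j => if i + j ≤ m then t (i + j) else 0

/-- The parameters `t₁, …, tₘ` (the values of `t` outside `{1, …, m}` are never used) are those of
a simple Parry sequence. -/
structure IsSimpleParry (m : ℕ) (t : ℕ → ℕ) : Prop where
  two_le : 2 ≤ m
  one_le_first : 1 ≤ t 1
  one_le_last : 1 ≤ t m
  lex : ∀ i : ℕ, 2 ≤ i → i ≤ m → toLex (tail m t i) < toLex (tail m t 1)

/-- The image of a letter: `a ↦ 0^{t_{a+1}} (a+1)` for `a < m - 1`, and `m - 1 ↦ 0^{t_m}`. -/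
def letterImage (m : ℕ) [NeZero m] (t : ℕ → ℕ) (a : Fin m) : List (Fin m) :=
  if h : a.val + 1 < m then List.replicate (t (a.val + 1)) 0 ++ [⟨a.val + 1, h⟩]
  else List.replicate (t m) 0

/-- The morphism `φ` on finite words over `{0, …, m - 1}`. -/
def morphism (m : ℕ) [NeZero m] (t : ℕ → ℕ) (w : List (Fin m)) : List (Fin m) :=
  w.flatMap (letterImage m t)

/-- The word `u_n = φⁿ(0)`. -/
def word (m : ℕ) [NeZero m] (t : ℕ → ℕ) (n : ℕ) : List (Fin m) := (morphism m t)^[n] [0]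

/-- `U_n = |u_n|`. -/
def U (m : ℕ) [NeZero m] (t : ℕ → ℕ) (n : ℕ) : ℕ := (word m t n).length

/-- `Γ_n = {U_i - 1 : max (0, n - m + 1) ≤ i ≤ n}` (the truncated subtraction `n + 1 - m`
is the maximum). -/
def Gam (m : ℕ) [NeZero m] (t : ℕ → ℕ) (n : ℕ) : Finset ℕ :=
  (Finset.Icc (n + 1 - m) n).image (fun i => U m t i - 1)

/-- The word `u_{n-m-1}^{t_2} u_{n-m-2}^{t_3} ⋯ u_{n-2m+1}^{t_m}`, where the words with a negative
index are empty. -/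
def zTail (m : ℕ) [NeZero m] (t : ℕ → ℕ) (n : ℕ) : List (Fin m) :=
  (List.range' 2 (m - 1)).flatMap
    (fun i => if m + i ≤ n + 1 then wpow (word m t (n + 1 - m - i)) (t i) else [])

/-- `z_n = u_n u_{n-m}^{t_1-t_m} u_{n-m-1}^{t_2} ⋯ u_{n-2m+1}^{t_m}`, used for `n ≥ m`. -/
def zWord (m : ℕ) [NeZero m] (t : ℕ → ℕ) (n : ℕ) : List (Fin m) :=
  word m t n ++ wpow (word m t (n - m)) (t 1 - t m) ++ zTail m t n

/-- `s_n = u_n u_{n-m}^{t_1-t_m+1} u_{n-m-1}^{t_2} ⋯ u_{n-2m+1}^{t_m}`, used for `n ≥ m`. -/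
def sWord (m : ℕ) [NeZero m] (t : ℕ → ℕ) (n : ℕ) : List (Fin m) :=
  word m t n ++ wpow (word m t (n - m)) (t 1 - t m + 1) ++ zTail m t n

/-- `Z_n = |z_n|`. -/
def Z (m : ℕ) [NeZero m] (t : ℕ → ℕ) (n : ℕ) : ℕ := (zWord m t n).length

/-- `S_n = |s_n|`. -/
def S (m : ℕ) [NeZero m] (t : ℕ → ℕ) (n : ℕ) : ℕ := (sWord m t n).length

/-- The word `u_j`, without its last letter if `j < m`. For `1 ≤ j < m` that last letter is `j`,
which does not occur in `u_0, …, u_{j-1}`. -/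
def coreWord (m : ℕ) [NeZero m] (t : ℕ → ℕ) (j : ℕ) : List (Fin m) :=
  if j < m then (word m t j).dropLast else word m t j

end SimpleParry

/-!
Two facts about the fixed point `u` carry the proof.

* By the Parry condition, `u_{n+1} = u_n^{t_1} u_{n-1}^{t_2} ⋯` (up to a last letter that is new,
  if `n + 1 < m`) is a prefix of a power of `u_n` (`digitWord_prefix_word`, `apply_mod_U`). So this
  part of `u` has the period `U_n`, and after `u_n` the sequence starts again.
* For `n ≥ m` the word `u_n` ends with `u_{n-m+k} u_{n-m}^{t_m}` (`suffix_word`). Since `u` starts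
  again after `u_n`, this end is continued like a prefix of `u`: from the start of `u_{n-m}^{t_m}`
  on with the period `U_{n-m}` (`apply_mod_of_suffix`), and from the start of
  `u_{n-m+k} u_{n-m}^{t_m}` on as in `u_{n-m+k+1}` (`apply_add_of_suffix`).

If `u_n` has an attractor `Γ`, then by the period `U_n` the set `Γ ∪ {U_n - 1}` is an attractor of
every longer prefix within `u_{n+1}`. For `n < m` this is all that happens, one position for each
new letter. For `n ≥ m` one position `e` of `Γ_{n-1}` has to be given up
(`PrefixAttractor.exchange`). A factor of `u_n` that needs `e = U_j - 1` lies within `u_{j+1}`,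
and for `j < n - 1` it avoids the last letter there, because `U_{j+1} - 1` belongs to the attractor
too. For `j = n - m` or
`j = n - m + k` such a factor occurs once more at the end of the prefix, at a copy of `e` by the
second fact, and this copy is the new position. The factors that end after `u_n` and avoid the new
position lie in a part that repeats a prefix of `u_n`, so that they are factors of `u_n`.

The sizes need only upper bounds, as an attractor has at least one position for each letter
(`card_toFinset_le_of_isAttractor`). The proofs work with positions in `u` rather than with finite
words (`PrefixAttractor`).
-/

namespace SimpleParry

/-! ### Occurrences of words in a sequence -/

section Words

variable {α : Type*}

theorem wpow_zero (w : List α) : wpow w 0 = [] := rfl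

theorem wpow_succ (w : List α) (k : ℕ) : wpow w (k + 1) = w ++ wpow w k := by
  simp [wpow, List.replicate_succ]

theorem wpow_add (w : List α) (j k : ℕ) : wpow w (j + k) = wpow w j ++ wpow w k := by
  rw [wpow, ← List.replicate_append_replicate, List.flatten_append]; rfl

theorem length_wpow (w : List α) (k : ℕ) : (wpow w k).length = k * w.length := by
  simp [wpow]

theorem length_pref (u : ℕ → α) (l : ℕ) : (pref u l).length = l := by
  simp [pref]

theorem pref_add (u : ℕ → α) (a b : ℕ) :
    pref u (a + b) = pref u a ++ pref (fun r => u (a + r)) b := by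
  simp [pref, List.range_add]

theorem pref_congr {u v : ℕ → α} {l : ℕ} (h : ∀ r < l, u r = v r) : pref u l = pref v l := by
  unfold pref
  exact List.map_congr_left fun r hr => h r (List.mem_range.1 hr)

theorem eq_of_pref_eq {u v : ℕ → α} {l : ℕ} (h : pref u l = pref v l) {r : ℕ} (hr : r < l) :
    u r = v r := by
  unfold pref at h
  exact List.map_inj_left.1 h r (List.mem_range.2 hr)

/-- The finite word `w` occurs in the sequence `u` at position `q`. -/
def OccursAt (u : ℕ → α) (q : ℕ) (w : List α) : Prop :=
  pref (fun r => u (q + r)) w.length = w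

theorem occursAt_append {u : ℕ → α} {q : ℕ} {v w : List α} :
    OccursAt u q (v ++ w) ↔ OccursAt u q v ∧ OccursAt u (q + v.length) w := by
  unfold OccursAt
  rw [List.length_append, pref_add]
  simp only [Nat.add_assoc]
  exact ⟨fun h => List.append_inj h (length_pref _ _), fun h => by rw [h.1, h.2]⟩

theorem occursAt_zero {u : ℕ → α} {w : List α} : OccursAt u 0 w ↔ pref u w.length = w := by
  simp [OccursAt]

theorem occursAt_pref (u : ℕ → α) (l : ℕ) : OccursAt u 0 (pref u l) := by
  rw [occursAt_zero, length_pref]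

theorem OccursAt.of_prefix {u : ℕ → α} {q : ℕ} {v w : List α} (h : OccursAt u q w)
    (hv : v <+: w) : OccursAt u q v := by
  obtain ⟨x, rfl⟩ := hv
  exact (occursAt_append.1 h).1

/-- Two occurrences of the same word carry the same letters. -/
theorem OccursAt.eq_shift {u : ℕ → α} {p q : ℕ} {w : List α} (hp : OccursAt u p w)
    (hq : OccursAt u q w) {i : ℕ} (hi : i < w.length) : u (p + i) = u (q + i) :=
  eq_of_pref_eq (hp.trans hq.symm) hi

theorem OccursAt.wpow_mod {u : ℕ → α} {w : List α} (hw : OccursAt u 0 w) :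
    ∀ {c q : ℕ}, OccursAt u q (wpow w c) → ∀ {i : ℕ}, i < c * w.length →
      u (q + i) = u (i % w.length)
  | 0, _, _, i, hi => by simp at hi
  | c + 1, q, h, i, hi => by
    rw [wpow_succ, occursAt_append] at h
    rcases lt_or_ge i w.length with hlt | hge
    · rw [Nat.mod_eq_of_lt hlt, h.1.eq_shift hw hlt, Nat.zero_add]
    · have := hw.wpow_mod h.2 (i := i - w.length) (by rw [Nat.succ_mul] at hi; omega)
      rw [Nat.mod_eq_sub_mod hge, ← this]
      congr 1
      omega

theorem pref_prefix_pref (u : ℕ → α) {a b : ℕ} (h : a ≤ b) : pref u a <+: pref u b := by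
  obtain ⟨c, rfl⟩ := Nat.exists_eq_add_of_le h
  exact ⟨_, (pref_add u a c).symm⟩

end Words

/-! ### The words `u_n` and the Parry condition -/

section Tail

variable (m : ℕ) (t : ℕ → ℕ)

theorem tail_shift (i c : ℕ) : (fun j => tail m t i (j + c)) = tail m t (i + c) := by
  funext j
  simp only [tail, show i + (j + c) = i + c + j by omega]

theorem tail_zero {i : ℕ} (h : i ≤ m) : tail m t i 0 = t i := by
  simp [tail, h]

theorem tail_of_lt {i : ℕ} (h : m < i) : tail m t i = fun _ => 0 := by
  funext j
  simp only [tail]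
  rw [if_neg (by omega)]

end Tail

section Morphism

variable (m : ℕ) [NeZero m] (t : ℕ → ℕ)

theorem morphism_append (v w : List (Fin m)) :
    morphism m t (v ++ w) = morphism m t v ++ morphism m t w := by
  simp [morphism]

theorem iterate_morphism_append (n : ℕ) : ∀ v w : List (Fin m),
    (morphism m t)^[n] (v ++ w) = (morphism m t)^[n] v ++ (morphism m t)^[n] w := by
  induction n with
  | zero => intro v w; rfl
  | succ n ih => intro v w; simp only [Function.iterate_succ_apply, morphism_append, ih]

theorem iterate_morphism_nil (n : ℕ) : (morphism m t)^[n] [] = [] := by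
  induction n with
  | zero => rfl
  | succ n ih => rw [Function.iterate_succ_apply]; exact ih

theorem iterate_morphism_replicate_zero (n c : ℕ) :
    (morphism m t)^[n] (List.replicate c 0) = wpow (word m t n) c := by
  induction c with
  | zero => exact iterate_morphism_nil m t n
  | succ c ih =>
    rw [List.replicate_succ, ← List.singleton_append, iterate_morphism_append, ih, wpow_succ]
    rfl

/-- The word `u_{n-1}^{f 0} u_{n-2}^{f 1} ⋯ u_0^{f (n-1)}` with the digits `f`. -/
def digitWord : (ℕ → ℕ) → ℕ → List (Fin m)
  | _, 0 => []
  | f, n + 1 => wpow (word m t n) (f 0) ++ digitWord (fun j => f (j + 1)) n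

theorem digitWord_zero_digits (n : ℕ) : digitWord m t (fun _ => 0) n = [] := by
  induction n with
  | zero => rfl
  | succ n ih => simp [digitWord, wpow_zero, ih]

theorem digitWord_tail_of_lt {i : ℕ} (h : m < i) (n : ℕ) : digitWord m t (tail m t i) n = [] := by
  rw [tail_of_lt m t h, digitWord_zero_digits]

theorem digitWord_tail_succ {i : ℕ} (h : i ≤ m) (n : ℕ) :
    digitWord m t (tail m t i) (n + 1) =
      wpow (word m t n) (t i) ++ digitWord m t (tail m t (i + 1)) n := by
  rw [digitWord, tail_zero m t h, tail_shift]

/-- The letter `n` as a one-letter word, and the empty word if `n` is no letter. -/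
def letterWord (n : ℕ) : List (Fin m) := if h : n < m then [⟨n, h⟩] else []

/-- `φⁿ(a) = u_{n-1}^{t_{a+1}} u_{n-2}^{t_{a+2}} ⋯`, ending with the letter `a + n` if there
is one. -/
theorem iterate_morphism_letter (n : ℕ) : ∀ a : Fin m,
    (morphism m t)^[n] [a] = digitWord m t (tail m t (a + 1)) n ++ letterWord m (a + n) := by
  induction n with
  | zero => intro a; simp [digitWord, letterWord]
  | succ n ih =>
    intro a
    have ha := a.isLt
    rw [Function.iterate_succ_apply, digitWord_tail_succ m t (by omega)]
    by_cases h : a.val + 1 < m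
    · have h1 : morphism m t [a] = List.replicate (t (a.val + 1)) 0 ++ [⟨a.val + 1, h⟩] := by
        simp [morphism, letterImage, h]
      rw [h1, iterate_morphism_append, ih, iterate_morphism_replicate_zero, List.append_assoc]
      simp only [show a.val + (n + 1) = a.val + 1 + n by omega]
    · have h1 : morphism m t [a] = List.replicate (t m) 0 := by
        simp [morphism, letterImage, h]
      have h2 : a.val + 1 = m := by omega
      rw [h1, iterate_morphism_replicate_zero, digitWord_tail_of_lt m t (by omega), h2,
        letterWord, dif_neg (by omega)]
      simp

/-- `u_n = u_{n-1}^{t_1} u_{n-2}^{t_2} ⋯ u_{n-m}^{t_m}`, with the letter `n` in place of the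
missing words if `n < m`. -/
theorem word_eq (n : ℕ) : word m t n = digitWord m t (tail m t 1) n ++ letterWord m n := by
  have := iterate_morphism_letter m t n 0
  simpa [word] using this

theorem coreWord_eq (n : ℕ) : coreWord m t n = digitWord m t (tail m t 1) n := by
  unfold coreWord
  rw [word_eq]
  split_ifs with h <;> simp [letterWord, h]

theorem word_eq_coreWord_append (n : ℕ) : word m t n = coreWord m t n ++ letterWord m n := by
  rw [coreWord_eq, word_eq]

theorem coreWord_succ (n : ℕ) : coreWord m t (n + 1) =
    wpow (word m t n) (t 1) ++ digitWord m t (tail m t 2) n := by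
  rw [coreWord_eq, digitWord_tail_succ m t (NeZero.one_le)]

theorem digitWord_eq_flatMap (n c : ℕ) : ∀ i : ℕ, i + c = m + 1 → i ≤ n + 2 - m → m ≤ n →
    digitWord m t (tail m t i) (n + 2 - m - i) = (List.range' i c).flatMap
      (fun i => if m + i ≤ n + 1 then wpow (word m t (n + 1 - m - i)) (t i) else []) := by
  induction c with
  | zero => intro i hi h1 h2; simpa using digitWord_tail_of_lt m t (by omega) _
  | succ c ih =>
    intro i hi h1 h2
    rw [List.range'_succ, List.flatMap_cons]
    split_ifs with h
    · rw [← ih (i + 1) (by omega) (by omega) h2,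
        show n + 2 - m - i = (n + 1 - m - i) + 1 by omega, digitWord_tail_succ m t (by omega),
        show n + 2 - m - (i + 1) = n + 1 - m - i by omega]
    · rw [show n + 2 - m - i = 0 by omega, digitWord, List.nil_append, eq_comm,
        List.flatMap_eq_nil_iff]
      intro j hj
      rw [List.mem_range'_1] at hj
      rw [if_neg (by omega)]

theorem zTail_eq {n : ℕ} (hn : m ≤ n) : zTail m t n = digitWord m t (tail m t 2) (n - m) := by
  have hm : 1 ≤ m := NeZero.one_le
  rw [zTail, ← digitWord_eq_flatMap m t n (m - 1) 2 (by omega) (by omega) hn,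
    show n + 2 - m - 2 = n - m by omega]

theorem digitWord_suffix (c : ℕ) : ∀ (f : ℕ → ℕ) (n : ℕ),
    digitWord m t (fun j => f (j + c)) n <:+ digitWord m t f (n + c) := by
  induction c with
  | zero => intro f n; exact List.suffix_rfl
  | succ c ih =>
    intro f n
    rw [← Nat.add_assoc n c 1, digitWord]
    exact (ih (fun j => f (j + 1)) n).trans (List.suffix_append _ _)

theorem digitWord_tail_suffix (i c n : ℕ) :
    digitWord m t (tail m t (i + c)) n <:+ digitWord m t (tail m t i) (n + c) := by
  rw [← tail_shift]
  exact digitWord_suffix m t c _ n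

theorem digitWord_tail_skip (c : ℕ) : ∀ i n : ℕ, i + c ≤ m → (∀ j, i ≤ j → j < i + c → t j = 0) →
    digitWord m t (tail m t i) (n + c) = digitWord m t (tail m t (i + c)) n := by
  induction c with
  | zero => intro i n _ _; rfl
  | succ c ih =>
    intro i n hi h
    rw [← Nat.add_assoc, digitWord_tail_succ m t (by omega), h i (by omega) (by omega), wpow_zero,
      List.nil_append, ih (i + 1) n (by omega) (fun j h1 h2 => h j (by omega) (by omega))]
    simp only [show i + 1 + c = i + (c + 1) by omega]

theorem digitWord_tail_last (n : ℕ) :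
    digitWord m t (tail m t m) (n + 1) = wpow (word m t n) (t m) := by
  rw [digitWord_tail_succ m t le_rfl, digitWord_tail_of_lt m t (by omega), List.append_nil]

variable {m t}

/-- If `t_{m-k}` is the last non-zero parameter before `t_m`, then `u_n` ends with
`u_{n-m+k} u_{n-m}^{t_m}`. -/
theorem suffix_word {k : ℕ} (hk : IsLeast {j : ℕ | 1 ≤ j ∧ j ≤ m - 1 ∧ t (m - j) ≠ 0} k)
    (N : ℕ) : word m t (N + k) ++ wpow (word m t N) (t m) <:+ word m t (N + m) := by
  obtain ⟨⟨hk1, hk2, hk3⟩, hmin⟩ := hk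
  obtain ⟨c, hc⟩ := Nat.exists_eq_add_of_le' (Nat.one_le_iff_ne_zero.2 hk3)
  have h1 := digitWord_tail_suffix m t 1 (m - k - 1) (N + k + 1)
  rw [show 1 + (m - k - 1) = m - k by omega, show N + k + 1 + (m - k - 1) = N + m by omega,
    digitWord_tail_succ m t (by omega)] at h1
  have h2 := digitWord_tail_skip m t (k - 1) (m - k + 1) (N + 1) (by omega) (by
    intro j hj1 hj2
    by_contra hne
    have : k ≤ m - j := hmin ⟨by omega, by omega, by rwa [show m - (m - j) = j by omega]⟩
    omega)
  rw [show N + 1 + (k - 1) = N + k by omega, show m - k + 1 + (k - 1) = m by omega,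
    digitWord_tail_last] at h2
  rw [h2, hc, wpow_add, wpow_succ, wpow_zero, List.append_nil, List.append_assoc] at h1
  rw [word_eq m t (N + m), letterWord, dif_neg (by omega), List.append_nil]
  exact (List.suffix_append _ _).trans h1

variable (ht : IsSimpleParry m t)
include ht

theorem word_prefix_succ (n : ℕ) : word m t n <+: word m t (n + 1) := by
  obtain ⟨c, hc⟩ := Nat.exists_eq_add_of_le' ht.one_le_first
  rw [word_eq_coreWord_append m t (n + 1), coreWord_succ, hc, wpow_succ]
  simp [List.append_assoc]

theorem word_prefix {i n : ℕ} (h : i ≤ n) : word m t i <+: word m t n := by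
  induction n, h using Nat.le_induction with
  | base => exact List.prefix_rfl
  | succ n _ ih => exact ih.trans (word_prefix_succ ht n)

theorem U_mono : Monotone (U m t) := fun _ _ h => (word_prefix ht h).length_le

theorem U_pos (n : ℕ) : 0 < U m t n := (U_mono ht (Nat.zero_le n)).trans_lt' (by simp [U, word])

/-- The Parry condition makes every word `u_{n-1}^{t_i} u_{n-2}^{t_{i+1}} ⋯` with `i ≥ 2` a prefix
of `u_n`: at the first digit where `tᵢ tᵢ₊₁ ⋯` is smaller than `t₁ t₂ ⋯`, the word `u_n` has a
further factor `u_j`, of which the remaining digits give a prefix. -/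
theorem digitWord_prefix_word (n : ℕ) : ∀ i : ℕ, 2 ≤ i →
    digitWord m t (tail m t i) n <+: word m t n := by
  induction n using Nat.strong_induction_on with
  | _ n ih =>
  intro i hi
  rcases lt_or_ge m i with him | him
  · rw [digitWord_tail_of_lt m t him]; exact List.nil_prefix
  obtain ⟨j, hj1, hj2⟩ := ht.lex i hi him
  replace hj1 : ∀ l < j, tail m t i l = tail m t 1 l := hj1
  replace hj2 : tail m t i j < tail m t 1 j := hj2
  rw [word_eq]
  refine List.IsPrefix.trans ?_ (List.prefix_append _ _)
  -- the comparison of two digit sequences whose first difference is at the index `c`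
  have key : ∀ (c : ℕ) (f g : ℕ → ℕ) (l : ℕ), l ≤ n → (∀ r < c, f r = g r) → f c < g c →
      (∀ p, p + c < l → digitWord m t (fun r => f (r + (c + 1))) p <+: word m t p) →
      digitWord m t f l <+: digitWord m t g l := by
    intro c
    induction c with
    | zero =>
      intro f g l hl _ hlt hp
      cases l with
      | zero => exact List.prefix_rfl
      | succ l =>
        obtain ⟨d, hd⟩ := Nat.exists_eq_add_of_lt hlt
        rw [digitWord, digitWord, hd, Nat.add_assoc, wpow_add, wpow_succ, List.append_assoc,
          List.prefix_append_right_inj, List.append_assoc]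
        exact (hp l (by omega)).trans (List.prefix_append _ _)
    | succ c ihc =>
      intro f g l hl heq hlt hp
      cases l with
      | zero => exact List.prefix_rfl
      | succ l =>
        rw [digitWord, digitWord, heq 0 (by omega), List.prefix_append_right_inj]
        exact ihc _ _ l (by omega) (fun r hr => heq (r + 1) (by omega)) hlt
          (fun p hp' => hp p (by omega))
  refine key j _ _ n le_rfl hj1 hj2 fun p hp => ?_
  rw [tail_shift]
  exact ih p (by omega) _ (by omega)

end Morphism

/-! ### Lengths -/

theorem t_last_le_first {m : ℕ} {t : ℕ → ℕ} (ht : IsSimpleParry m t) : t m ≤ t 1 := by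
  obtain ⟨j, hj1, hj2⟩ := ht.lex m ht.two_le le_rfl
  replace hj1 : ∀ l < j, tail m t m l = tail m t 1 l := hj1
  replace hj2 : tail m t m j < tail m t 1 j := hj2
  have hm := ht.two_le
  rw [← tail_zero m t (i := m) le_rfl, ← tail_zero m t (i := 1) (by omega)]
  rcases Nat.eq_zero_or_pos j with rfl | hj
  · exact hj2.le
  · exact (hj1 0 hj).le

section Lengths

variable {m : ℕ} [NeZero m] {t : ℕ → ℕ}

theorem length_word (n : ℕ) : (word m t n).length = U m t n := rfl

theorem U_eq (n : ℕ) : U m t n = (coreWord m t n).length + if n < m then 1 else 0 := by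
  rw [U, word_eq_coreWord_append, List.length_append, letterWord]
  split_ifs <;> rfl

theorem length_coreWord_of_le {n : ℕ} (h : m ≤ n) : (coreWord m t n).length = U m t n := by
  rw [U_eq, if_neg (by omega)]; rfl

theorem length_coreWord_le (n : ℕ) : (coreWord m t n).length ≤ U m t n := by
  rw [U_eq]; omega

theorem U_le_length_coreWord_add_one (n : ℕ) : U m t n ≤ (coreWord m t n).length + 1 := by
  rw [U_eq]; split_ifs <;> omega

theorem length_coreWord_succ (n : ℕ) : (coreWord m t (n + 1)).length =
    t 1 * U m t n + (digitWord m t (tail m t 2) n).length := by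
  rw [coreWord_succ, List.length_append, length_wpow, length_word]

theorem Z_eq {n : ℕ} (hn : m ≤ n) : Z m t n =
    U m t n + (t 1 - t m) * U m t (n - m) + (digitWord m t (tail m t 2) (n - m)).length := by
  rw [Z, zWord, List.length_append, List.length_append, length_wpow, zTail_eq m t hn]
  rfl

theorem S_eq {n : ℕ} (hn : m ≤ n) : S m t n =
    U m t n + (t 1 - t m + 1) * U m t (n - m)
      + (digitWord m t (tail m t 2) (n - m)).length := by
  rw [S, sWord, List.length_append, List.length_append, length_wpow, zTail_eq m t hn]
  rfl

theorem Z_le_S {n : ℕ} (hn : m ≤ n) : Z m t n ≤ S m t n := by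
  rw [Z_eq hn, S_eq hn, Nat.succ_mul]
  omega

variable (ht : IsSimpleParry m t)
include ht

theorem U_add_le {N n : ℕ} (h : n + 1 = N + m) : U m t n + U m t N ≤ U m t (n + 1) := by
  have hm := ht.two_le
  have h1 := (digitWord_tail_suffix m t 2 (m - 2) (N + 1)).length_le
  rw [show 2 + (m - 2) = m by omega, digitWord_tail_last, length_wpow, length_word,
    show N + 1 + (m - 2) = n by omega] at h1
  have h2 := length_coreWord_le (t := t) (m := m) (n + 1)
  rw [length_coreWord_succ] at h2
  have h3 := Nat.le_mul_of_pos_left (U m t n) ht.one_le_first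
  have h4 := Nat.le_mul_of_pos_left (U m t N) ht.one_le_last
  omega

theorem U_strictMono : StrictMono (U m t) := by
  refine strictMono_nat_of_lt_succ fun n => ?_
  rcases lt_or_ge (n + 1) m with h | h
  · have h1 := U_eq (t := t) (m := m) (n + 1)
    rw [length_coreWord_succ, if_pos h] at h1
    have h3 := Nat.le_mul_of_pos_left (U m t n) ht.one_le_first
    omega
  · have h1 := U_add_le ht (N := n + 1 - m) (n := n) (by omega)
    have h2 := U_pos ht (n + 1 - m)
    omega

theorem length_digitWord_le {i : ℕ} (hi : 2 ≤ i) (n : ℕ) :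
    (digitWord m t (tail m t i) n).length ≤ U m t n :=
  (digitWord_prefix_word ht n i hi).length_le

theorem S_le {n : ℕ} (hn : m ≤ n) : S m t n ≤ U m t (n + 1) := by
  have h1 := U_add_le ht (N := n + 1 - m) (n := n) (by omega)
  have h2 := length_coreWord_le (t := t) (m := m) (n - m + 1)
  rw [length_coreWord_succ, show n - m + 1 = n + 1 - m by omega] at h2
  have h3 : (t 1 - t m + 1) * U m t (n - m) ≤ t 1 * U m t (n - m) :=
    Nat.mul_le_mul_right _ (by have := ht.one_le_last; have := t_last_le_first ht; omega)
  rw [S_eq hn]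
  omega

end Lengths

/-! ### Periods of the fixed point -/

section FixedPoint

variable {m : ℕ} [NeZero m] {t : ℕ → ℕ} (ht : IsSimpleParry m t)
  {u : ℕ → Fin m} (hu : IsFixedPoint (morphism m t) u)
include ht hu

theorem fixedPoint_zero : u 0 = 0 := by
  have h := hu.1 1
  have h1 : pref u 1 = [u 0] := rfl
  have h2 : morphism m t (pref u 1) = letterImage m t (u 0) := by simp [h1, morphism]
  rw [h2] at h
  have hl : ∀ a : Fin m, ∃ b w, letterImage m t a = b :: w ∧ (b = 0 ∨ b.val = a.val + 1) := by
    intro a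
    unfold letterImage
    split_ifs with ha
    · rcases Nat.eq_zero_or_pos (t (a.val + 1)) with h0 | h0
      · exact ⟨_, [], by simp [h0]; rfl, Or.inr rfl⟩
      · obtain ⟨c, hc⟩ := Nat.exists_eq_add_of_le' h0
        exact ⟨0, _, by rw [hc, List.replicate_succ, List.cons_append], Or.inl rfl⟩
    · obtain ⟨c, hc⟩ := Nat.exists_eq_add_of_le' ht.one_le_last
      exact ⟨0, _, by rw [hc, List.replicate_succ], Or.inl rfl⟩
  obtain ⟨b, w, hb, hb'⟩ := hl (u 0)
  rw [hb, List.length_cons, Nat.add_comm, pref_add, h1] at h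
  have h3 : b = u 0 := (List.cons.inj h).1
  rcases hb' with h4 | h4
  · rw [← h3, h4]
  · rw [h3] at h4; omega

theorem pref_U (n : ℕ) : pref u (U m t n) = word m t n := by
  induction n with
  | zero =>
    have : pref u 1 = [u 0] := rfl
    rw [fixedPoint_zero ht hu] at this
    exact this
  | succ n ih =>
    have h1 : morphism m t (word m t n) = word m t (n + 1) :=
      (Function.iterate_succ_apply' _ _ _).symm
    have h := hu.1 (U m t n)
    rw [ih, h1] at h
    exact h.symm

theorem occursAt_word (n : ℕ) : OccursAt u 0 (word m t n) :=
  occursAt_zero.2 (pref_U ht hu n)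

/-- The word `u_{n+1}`, up to a last letter that occurs only once, has the period `U_n`. -/
theorem apply_mod_U {n x : ℕ} (hx : x < (coreWord m t (n + 1)).length) : u x = u (x % U m t n) := by
  have h1 : OccursAt u 0 (coreWord m t (n + 1)) := by
    refine (occursAt_word ht hu (n + 1)).of_prefix ?_
    rw [word_eq_coreWord_append]
    exact List.prefix_append _ _
  have hd := digitWord_prefix_word ht n 2 le_rfl
  rw [length_coreWord_succ] at hx
  rw [coreWord_succ, occursAt_append, length_wpow, Nat.zero_add] at h1
  rcases lt_or_ge x (t 1 * U m t n) with h | h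
  · simpa [length_word] using (occursAt_word ht hu n).wpow_mod h1.1 h
  · obtain ⟨r, rfl⟩ := Nat.exists_eq_add_of_le h
    have hr : r < (digitWord m t (tail m t 2) n).length := by omega
    have h2 := h1.2.eq_shift ((occursAt_word ht hu n).of_prefix hd) hr
    rw [Nat.mul_comm, Nat.mul_add_mod,
      Nat.mod_eq_of_lt (hr.trans_le (length_digitWord_le ht le_rfl n)), Nat.mul_comm]
    simpa [length_word] using h2

/-- After `u_n` the sequence starts again, up to the end of `u_{n+1}`. -/
theorem apply_U_add {n x : ℕ} (hx : U m t n + x < (coreWord m t (n + 1)).length) :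
    u (U m t n + x) = u x := by
  rw [apply_mod_U ht hu hx, Nat.add_mod_left, ← apply_mod_U ht hu (by omega)]

/-- The end of `u_n`, from the start of its suffix `u_{n-m}^{t_m}`, is continued with the period
`U_{n-m}`. -/
theorem apply_mod_of_suffix {k : ℕ}
    (hk : IsLeast {j : ℕ | 1 ≤ j ∧ j ≤ m - 1 ∧ t (m - j) ≠ 0} k) {N a x : ℕ}
    (ha : a + t m * U m t N = U m t (N + m))
    (hx : x < t m * U m t N + (coreWord m t (N + 1)).length) :
    u (a + x) = u (x % U m t N) := by
  rcases lt_or_ge x (t m * U m t N) with h | h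
  · have h1 : OccursAt u a (wpow (word m t N) (t m)) := by
      obtain ⟨y, hy⟩ := suffix_word hk N
      rw [← List.append_assoc] at hy
      have hl := congrArg List.length hy
      rw [List.length_append, length_wpow, length_word, length_word] at hl
      have h2 := occursAt_word ht hu (N + m)
      rw [← hy, occursAt_append, Nat.zero_add] at h2
      rw [show a = (y ++ word m t (N + k)).length by omega]
      exact h2.2
    exact (occursAt_word ht hu N).wpow_mod h1 h
  · obtain ⟨r, rfl⟩ := Nat.exists_eq_add_of_le h
    have h1 := U_add_le ht (N := N + 1) (n := N + m) (by omega)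
    have h2 := length_coreWord_le (m := m) (t := t) (N + 1)
    have h3 := length_coreWord_of_le (t := t) (show m ≤ N + m + 1 by omega)
    rw [← Nat.add_assoc, ha, apply_U_add ht hu (by omega), apply_mod_U ht hu (n := N) (by omega),
      Nat.mul_comm, Nat.mul_add_mod]

end FixedPoint

/-! ### Attractors of prefixes -/

section Attractor

variable {α : Type*}

/-- The factor `u_i ⋯ u_{i+d-1}` of the prefix of length `l` of `u` has an occurrence in this
prefix that contains a position from `Γ`. -/
def Hits (u : ℕ → α) (l : ℕ) (Γ : Finset ℕ) (i d : ℕ) : Prop :=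
  ∃ i', i' + d ≤ l ∧ (∀ r < d, u (i' + r) = u (i + r)) ∧ ∃ p ∈ Γ, i' ≤ p ∧ p < i' + d

/-- `Γ` is an attractor of the prefix of length `l` of `u`, in terms of positions. -/
def PrefixAttractor (u : ℕ → α) (l : ℕ) (Γ : Finset ℕ) : Prop :=
  (∀ p ∈ Γ, p < l) ∧ ∀ i d, 0 < d → i + d ≤ l → Hits u l Γ i d

variable {u : ℕ → α} {l N : ℕ} {Γ Δ : Finset ℕ}

theorem Hits.mono {i d : ℕ} (h : Hits u N Γ i d) (hl : N ≤ l) (hΓ : Γ ⊆ Δ) : Hits u l Δ i d := by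
  obtain ⟨i', h1, h2, p, hp, h3⟩ := h
  exact ⟨i', h1.trans hl, h2, p, hΓ hp, h3⟩

theorem Hits.congr {i j d : ℕ} (h : Hits u l Γ i d) (hij : ∀ r < d, u (i + r) = u (j + r)) :
    Hits u l Γ j d := by
  obtain ⟨i', h1, h2, hp⟩ := h
  exact ⟨i', h1, fun r hr => (h2 r hr).trans (hij r hr), hp⟩

theorem Hits.self {i d p : ℕ} (hl : i + d ≤ l) (hp : p ∈ Γ) (h1 : i ≤ p) (h2 : p < i + d) :
    Hits u l Γ i d :=
  ⟨i, hl, fun _ _ => rfl, p, hp, h1, h2⟩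

theorem PrefixAttractor.isAttractor (h : PrefixAttractor u l Γ) : IsAttractor (pref u l) Γ := by
  refine ⟨fun p hp => by rw [length_pref]; exact h.1 p hp, ?_⟩
  rintro f hf ⟨x, y, hxy⟩
  have hlen : l = x.length + f.length + y.length := by
    rw [← length_pref u l, ← hxy, List.length_append, List.length_append]
  obtain ⟨i, h1, h2, p, hp, h3, h4⟩ :=
    h.2 x.length f.length (List.length_pos_iff.2 hf) (by omega)
  obtain ⟨c, rfl⟩ := Nat.exists_eq_add_of_le h1
  have hf' : pref (fun r => u (i + r)) f.length = f := by
    rw [pref_congr h2]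
    have h5 := occursAt_pref u (i + f.length + c)
    rw [← hxy, occursAt_append, occursAt_append, Nat.zero_add] at h5
    exact h5.1.2
  refine ⟨pref u i, pref (fun r => u (i + f.length + r)) c, ?_, p, hp, ?_, ?_⟩
  · rw [pref_add, pref_add, hf']
  · rwa [length_pref]
  · rwa [length_pref]

/-- The new attractor `Δ` of a longer prefix is obtained by giving up the position `e` of `Γ`:
the factors that only `e` took care of, and the factors that end after the old prefix, have to be
found elsewhere. -/
theorem PrefixAttractor.exchange {e : ℕ} (h : PrefixAttractor u N Γ) (hN : N ≤ l)
    (hΔ : ∀ p ∈ Δ, p < l) (hsub : Γ.erase e ⊆ Δ)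
    (hold : ∀ i d, i + d ≤ N → i ≤ e → e < i + d →
      (∀ p ∈ Γ, p ≠ e → i ≤ p → i + d ≤ p) → Hits u l Δ i d)
    (hnew : ∀ i d, 0 < d → i + d ≤ l → N < i + d →
      Hits u l Δ i d ∨ ∃ j, j + d ≤ N ∧ ∀ r < d, u (j + r) = u (i + r)) :
    PrefixAttractor u l Δ := by
  have key : ∀ i d, 0 < d → i + d ≤ N → Hits u l Δ i d := by
    intro i d hd hi
    obtain ⟨j, h1, h2, p, hp, h3, h4⟩ := h.2 i d hd hi
    refine Hits.congr ?_ h2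
    by_cases hq : ∃ q ∈ Γ, q ≠ e ∧ j ≤ q ∧ q < j + d
    · obtain ⟨q, hq1, hq2, hq3, hq4⟩ := hq
      exact Hits.self (h1.trans hN) (hsub (Finset.mem_erase.2 ⟨hq2, hq1⟩)) hq3 hq4
    · push Not at hq
      have hpe : p = e := by
        by_contra hne
        exact absurd (hq p hp hne h3) (by omega)
      subst hpe
      exact hold j d h1 h3 h4 hq
  refine ⟨hΔ, fun i d hd hi => ?_⟩
  rcases le_or_gt (i + d) N with hle | hgt
  · exact key i d hd hle
  · rcases hnew i d hd hi hgt with h1 | ⟨j, h1, h2⟩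
    · exact h1
    · exact (key j d hd h1).congr h2

/-- A factor of a prefix with period `N` contains the position `N - 1` after a shift by a multiple
of `N`, or else it is a factor of the first period. -/
theorem hits_or_of_period {i d : ℕ} (hN : 0 < N) (hp : ∀ x < l, u x = u (x % N)) (hi : i + d ≤ l)
    (hΔ : N - 1 ∈ Δ) : Hits u l Δ i d ∨ ∃ j, j + d ≤ N ∧ ∀ r < d, u (j + r) = u (i + r) := by
  have hmod := Nat.mod_le i N
  have hlt := Nat.mod_lt i hN
  have hsame : ∀ r < d, u (i % N + r) = u (i + r) := by
    intro r hr
    rw [hp (i % N + r) (by omega), hp (i + r) (by omega), Nat.mod_add_mod]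
  rcases le_or_gt (i % N + d) N with h | h
  · exact Or.inr ⟨i % N, h, hsame⟩
  · exact Or.inl (Hits.congr (Hits.self (by omega) hΔ (by omega) (by omega)) hsame)

theorem PrefixAttractor.insert_of_period (h : PrefixAttractor u N Γ) (hN : 0 < N) (hl : N ≤ l)
    (hp : ∀ x < l, u x = u (x % N)) (hΔ : N - 1 ∈ Δ) (hsub : Γ ⊆ Δ) (hlt : ∀ p ∈ Δ, p < l) :
    PrefixAttractor u l Δ := by
  -- no position is given up: `N` is not in `Γ`
  refine h.exchange (e := N) hl hlt ((Finset.erase_subset _ _).trans hsub) ?_ ?_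
  · intro i d h1 h2 h3; omega
  · intro i d _ h1 _
    exact hits_or_of_period hN hp h1 hΔ

theorem card_toFinset_le_of_isAttractor [DecidableEq α] {w : List α} (h : IsAttractor w Γ) :
    w.toFinset.card ≤ Γ.card := by
  have hsub : (w.toFinset.image some) ⊆ Γ.image (fun p => w[p]?) := by
    intro a ha
    simp only [Finset.mem_image, List.mem_toFinset] at ha ⊢
    obtain ⟨b, hb, rfl⟩ := ha
    obtain ⟨s, r, rfl⟩ := List.append_of_mem hb
    obtain ⟨x, y, hxy, p, hp, h1, h2⟩ := h.2 [b] (by simp) ⟨s, r, by simp⟩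
    refine ⟨p, hp, ?_⟩
    rw [hxy, List.length_singleton] at *
    obtain rfl : p = x.length := by omega
    simp
  calc w.toFinset.card = (w.toFinset.image some).card :=
        (Finset.card_image_of_injective _ (Option.some_injective _)).symm
    _ ≤ _ := (Finset.card_le_card hsub).trans Finset.card_image_le

theorem PrefixAttractor.isLetterSizeAttractor [DecidableEq α] (h : PrefixAttractor u l Γ)
    (hc : Γ.card ≤ (pref u l).toFinset.card) : IsLetterSizeAttractor (pref u l) Γ := by
  have := h.isAttractor
  exact ⟨⟨this, fun Γ' h' => hc.trans (card_toFinset_le_of_isAttractor h')⟩,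
    hc.antisymm (card_toFinset_le_of_isAttractor this)⟩

end Attractor

/-! ### The sets `Γ_n` and the words `u_n` with `n ≤ m` -/

section Gam

variable {m : ℕ} [NeZero m] {t : ℕ → ℕ}

theorem mem_Gam {n p : ℕ} : p ∈ Gam m t n ↔ ∃ i, n + 1 - m ≤ i ∧ i ≤ n ∧ U m t i - 1 = p := by
  simp [Gam, and_assoc]

theorem U_sub_one_mem_Gam {n i : ℕ} (h1 : n + 1 - m ≤ i) (h2 : i ≤ n) : U m t i - 1 ∈ Gam m t n :=
  mem_Gam.2 ⟨i, h1, h2, rfl⟩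

theorem card_Gam_le (n : ℕ) : (Gam m t n).card ≤ min (n + 1) m := by
  refine Finset.card_image_le.trans ?_
  rw [Nat.card_Icc]
  omega

theorem card_insert_erase_Gam_le {n i q : ℕ} (h1 : n + 1 - m ≤ i) (h2 : i ≤ n) :
    (insert q ((Gam m t n).erase (U m t i - 1))).card ≤ m := by
  refine (Finset.card_insert_le _ _).trans ?_
  rw [Finset.card_erase_add_one (U_sub_one_mem_Gam h1 h2)]
  exact (card_Gam_le n).trans (min_le_right _ _)

variable (ht : IsSimpleParry m t)
include ht

theorem lt_U_of_mem_Gam {n p : ℕ} (h : p ∈ Gam m t n) : p < U m t n := by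
  obtain ⟨i, _, h2, rfl⟩ := mem_Gam.1 h
  have h3 := U_mono ht h2
  have h4 := U_pos ht i
  omega

theorem le_card_toFinset_word (n : ℕ) : min (n + 1) m ≤ (word m t n).toFinset.card := by
  have hsub : Finset.univ.filter (fun a : Fin m => a.val ≤ n) ⊆ (word m t n).toFinset := by
    intro a ha
    rw [Finset.mem_filter] at ha
    rw [List.mem_toFinset]
    refine (word_prefix ht ha.2).subset ?_
    rw [word_eq, letterWord, dif_pos a.isLt]
    simp
  refine le_trans ?_ (Finset.card_le_card hsub)
  rw [← Finset.card_map Fin.valEmbedding, ← Finset.card_range (min (n + 1) m)]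
  refine Finset.card_le_card fun x hx => ?_
  rw [Finset.mem_range] at hx
  simp only [Finset.mem_map, Finset.mem_filter, Finset.mem_univ, true_and]
  exact ⟨⟨x, by omega⟩, by simp; omega, rfl⟩

variable {u : ℕ → Fin m} (hu : IsFixedPoint (morphism m t) u)
include hu

theorem le_card_toFinset_pref {n l : ℕ} (h : U m t n ≤ l) :
    min (n + 1) m ≤ (pref u l).toFinset.card := by
  refine (le_card_toFinset_word ht n).trans (Finset.card_le_card ?_)
  rw [← pref_U ht hu]
  exact fun a ha => List.mem_toFinset.2 ((pref_prefix_pref u h).subset (List.mem_toFinset.1 ha))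

theorem isLetterSizeAttractor_of_card_le {n l : ℕ} {Γ : Finset ℕ} (hn : m ≤ n + 1)
    (h : U m t n ≤ l) (hΓ : PrefixAttractor u l Γ) (hc : Γ.card ≤ m) :
    IsLetterSizeAttractor (pref u l) Γ := by
  refine hΓ.isLetterSizeAttractor (hc.trans ?_)
  have := le_card_toFinset_pref ht hu h
  omega

/-- While the words `u_n` end with new letters, each of them adds its last position to the
attractor, and the rest of `u_{n+1}` has the period `U_n`. -/
theorem prefixAttractor_Gam_small (n : ℕ) (hn : n < m) : ∀ l, U m t n ≤ l →
    l ≤ (coreWord m t (n + 1)).length → PrefixAttractor u l (Gam m t n) := by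
  intro l h1 h2
  have hlt : ∀ p ∈ Gam m t n, p < l := fun p hp => (lt_U_of_mem_Gam ht hp).trans_le h1
  have hmem : U m t n - 1 ∈ Gam m t n := U_sub_one_mem_Gam (by omega) le_rfl
  have hpos := U_pos ht n
  refine PrefixAttractor.insert_of_period (N := U m t n) (Γ := Gam m t n) ?_ hpos h1
    (fun x hx => apply_mod_U ht hu (by omega)) hmem subset_rfl hlt
  clear h1 h2 hlt
  cases n with
  | zero =>
    refine ⟨fun p hp => lt_U_of_mem_Gam ht hp, fun i d hd hi => Hits.self hi hmem ?_ ?_⟩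
    all_goals
      have : U m t 0 = 1 := rfl
      omega
  | succ n =>
    have hU := U_eq (t := t) (m := m) (n + 1)
    rw [if_pos hn] at hU
    have h3 := U_strictMono ht (Nat.lt_succ_self n)
    have ih := prefixAttractor_Gam_small n (by omega) _
      (by simp only [Nat.succ_eq_add_one] at h3; omega) le_rfl
    refine ⟨fun p hp => lt_U_of_mem_Gam ht hp, fun i d hd hi => ?_⟩
    rcases le_or_gt (i + d) (coreWord m t (n + 1)).length with h | h
    · refine (ih.2 i d hd h).mono (length_coreWord_le _) fun p hp => ?_
      obtain ⟨j, h4, h5, rfl⟩ := mem_Gam.1 hp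
      exact U_sub_one_mem_Gam (by omega) (by omega)
    · exact Hits.self hi hmem (by omega) (by omega)

end Gam

/-! ### Attractors from `u_m` on -/

theorem exists_isLeast_parameter {m : ℕ} {t : ℕ → ℕ} (ht : IsSimpleParry m t) :
    ∃ k, IsLeast {j : ℕ | 1 ≤ j ∧ j ≤ m - 1 ∧ t (m - j) ≠ 0} k := by
  have h2 := ht.two_le
  have h1 := ht.one_le_first
  have h : ∃ j, 1 ≤ j ∧ j ≤ m - 1 ∧ t (m - j) ≠ 0 :=
    ⟨m - 1, by omega, le_rfl, by rw [show m - (m - 1) = 1 by omega]; omega⟩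
  classical
  exact ⟨Nat.find h, Nat.find_spec h, fun j hj => Nat.find_min' h hj⟩

section Steps

variable {m : ℕ} [NeZero m] {t : ℕ → ℕ} (ht : IsSimpleParry m t)
include ht

variable {u : ℕ → Fin m} {N l : ℕ}
  (h : PrefixAttractor u (U m t (N + m)) (Gam m t (N + m - 1)))
include h

/-- If the end of the prefix, from the start `q` of the suffix `u_{n-m+k} u_{n-m}^{t_m}` of `u_n`
on (where `n = N + m`), is a prefix of `u_{n-m+k+1}`, then the position `U_{n-m} - 1` can be
replaced by its copy in this end. -/
theorem prefixAttractor_of_le {k q : ℕ}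
    (hk : IsLeast {j : ℕ | 1 ≤ j ∧ j ≤ m - 1 ∧ t (m - j) ≠ 0} k)
    (hq : q + U m t (N + k) + t m * U m t N = U m t (N + m)) (hU : U m t (N + m) ≤ l)
    (hl : l ≤ q + U m t (N + k + 1)) (hs : ∀ x, q + x < l → u (q + x) = u x) :
    PrefixAttractor u l (insert (U m t (N + m) - U m t (N + k) - (t m - 1) * U m t N - 1)
      ((Gam m t (N + m - 1)).erase (U m t N - 1))) := by
  have hm := ht.two_le
  have hk1 := hk.1.1
  have hk2 := hk.1.2.1
  have hVpos := U_pos ht N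
  have hN1 := U_strictMono ht (Nat.lt_succ_self N)
  simp only [Nat.succ_eq_add_one] at hN1
  have hle := Nat.le_mul_of_pos_left (U m t N) ht.one_le_last
  have hNk := U_mono ht (show N + 1 ≤ N + k by omega)
  have hp : U m t (N + m) - U m t (N + k) - (t m - 1) * U m t N - 1 = q + U m t N - 1 := by
    rw [Nat.sub_mul, Nat.one_mul]
    omega
  rw [hp]
  refine h.exchange (e := U m t N - 1) hU ?_ (Finset.subset_insert _ _) ?_ ?_
  · intro p hp
    rcases Finset.mem_insert.1 hp with rfl | hp
    · omega
    · have h1 := lt_U_of_mem_Gam ht (Finset.mem_of_mem_erase hp)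
      have h2 := U_mono ht (show N + m - 1 ≤ N + m by omega)
      omega
  · intro i d h1 h2 h3 h4
    have h5 := h4 (U m t (N + 1) - 1) (U_sub_one_mem_Gam (by omega) (by omega)) (by omega)
      (by omega)
    refine Hits.congr (i := q + i) (Hits.self (p := q + U m t N - 1) (by omega)
      (Finset.mem_insert_self _ _) (by omega) (by omega)) fun r hr => ?_
    rw [Nat.add_assoc, hs _ (by omega)]
  · intro i d hd h1 h2
    rcases le_or_gt i (q + U m t N - 1) with hi | hi
    · exact Or.inl (Hits.self h1 (Finset.mem_insert_self _ _) hi (by omega))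
    obtain ⟨x, rfl⟩ := Nat.exists_eq_add_of_le (show q ≤ i by omega)
    have := U_mono ht (show N + k + 1 ≤ N + m by omega)
    refine Or.inr ⟨x, by omega, fun r hr => ?_⟩
    rw [Nat.add_assoc, hs _ (by omega)]

variable (hu : IsFixedPoint (morphism m t) u)
include hu

/-- A factor for which only the position `U_{n-m} - 1` was of use (where `n = N + m`) can be moved
to the suffix `u_{n-m}^{t_m}` of `u_n`, and there by a multiple of the period `U_{n-m}`, so that
it contains the last position of `u_n`. -/
theorem prefixAttractor_Gam (hZ : Z m t (N + m) ≤ l) (hV : U m t (N + m) + U m t N ≤ l)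
    (hl : l ≤ U m t (N + m + 1)) : PrefixAttractor u l (Gam m t (N + m)) := by
  obtain ⟨k, hk⟩ := exists_isLeast_parameter ht
  have hm := ht.two_le
  have htm := t_last_le_first ht
  have hVpos := U_pos ht N
  have hN1 := U_strictMono ht (Nat.lt_succ_self N)
  simp only [Nat.succ_eq_add_one] at hN1
  obtain ⟨a, ha⟩ : ∃ a, a + t m * U m t N = U m t (N + m) := by
    have := (suffix_word hk N).length_le
    rw [List.length_append, length_wpow, length_word, length_word, length_word] at this
    exact ⟨U m t (N + m) - t m * U m t N, by omega⟩
  have hL := length_coreWord_succ (m := m) (t := t) N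
  have hLU := U_le_length_coreWord_add_one (m := m) (t := t) (N + 1)
  rw [Z_eq (by omega), Nat.add_sub_cancel, Nat.sub_mul] at hZ
  have hmul : t m * U m t N ≤ t 1 * U m t N := Nat.mul_le_mul_right _ htm
  refine h.exchange (e := U m t N - 1) (by omega)
    (fun p hp => (lt_U_of_mem_Gam ht hp).trans_le (by omega)) ?_ ?_ ?_
  · intro p hp
    obtain ⟨hp1, hp2⟩ := Finset.mem_erase.1 hp
    obtain ⟨i, h1, h2, rfl⟩ := mem_Gam.1 hp2
    have : i ≠ N := by rintro rfl; exact hp1 rfl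
    exact U_sub_one_mem_Gam (by omega) (by omega)
  · intro i d h1 h2 h3 h4
    have h5 := h4 (U m t (N + 1) - 1) (U_sub_one_mem_Gam (by omega) (by omega)) (by omega)
      (by omega)
    -- the shift by `c` periods keeps the start of the factor in `u_n`:
    -- `c` is the least number of periods that moves the end of the factor past the end of `u_n`
    obtain ⟨c, hc1, hc2, hc3⟩ : ∃ c, t m * U m t N ≤ i + c * U m t N + d ∧
        i + c * U m t N < t m * U m t N ∧
        (c = 0 ∨ i + c * U m t N + d < t m * U m t N + U m t N) := by
      have hsub : (t m - 1) * U m t N + U m t N = t m * U m t N := by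
        have := Nat.le_mul_of_pos_left (U m t N) ht.one_le_last
        rw [Nat.sub_mul, Nat.one_mul]
        omega
      have hlast : t m * U m t N ≤ i + (t m - 1) * U m t N + d := by omega
      have hex : ∃ c, t m * U m t N ≤ i + c * U m t N + d := ⟨_, hlast⟩
      classical
      have hle := Nat.mul_le_mul_right (U m t N) (Nat.find_min' hex hlast)
      refine ⟨Nat.find hex, Nat.find_spec hex, by omega, ?_⟩
      have hmin := fun c => Nat.find_min hex (m := c)
      generalize Nat.find hex = c at hmin
      cases c with
      | zero => exact Or.inl rfl
      | succ c =>
        have := hmin c (Nat.lt_succ_self c)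
        rw [Nat.succ_mul]
        exact Or.inr (by omega)
    have hend : i + c * U m t N + d ≤ l - a := by
      rcases hc3 with rfl | hc3
      · rw [Nat.zero_mul]; omega
      · omega
    have hcore : i + c * U m t N + d ≤ t m * U m t N + (coreWord m t (N + 1)).length := by
      rcases hc3 with rfl | hc3
      · rw [Nat.zero_mul]; omega
      · omega
    refine Hits.congr (i := a + (i + c * U m t N)) (Hits.self (p := U m t (N + m) - 1)
      (by omega) (U_sub_one_mem_Gam (by omega) le_rfl) (by omega) (by omega)) fun r hr => ?_
    rw [Nat.add_assoc, apply_mod_of_suffix ht hu hk ha (by omega),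
      apply_mod_U ht hu (n := N) (x := i + r) (by omega),
      show i + c * U m t N + r = i + r + U m t N * c by ring, Nat.add_mul_mod_self_left]
  · intro i d _ h1 _
    refine hits_or_of_period (U_pos ht _) (fun x hx => apply_mod_U ht hu ?_) h1
      (U_sub_one_mem_Gam (by omega) le_rfl)
    rw [length_coreWord_of_le (by omega)]
    omega

/-- If `t_1 = t_m`, the position `U_{n-m} - 1` (where `n = N + m`) is replaced by the end of the
first factor of the suffix `u_{n-m}^{t_m}` of `u_n`. The end of the prefix has the period `U_{n-m}`
from the start of this suffix on, so that no position near the end of `u_n` is needed. -/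
theorem prefixAttractor_of_first_eq_last (h1m : t 1 = t m) (hZ : Z m t (N + m) ≤ l)
    (hS : l ≤ S m t (N + m)) :
    PrefixAttractor u l (insert (U m t (N + m) - (t m - 1) * U m t N - 1)
      ((Gam m t (N + m - 1)).erase (U m t N - 1))) := by
  obtain ⟨k, hk⟩ := exists_isLeast_parameter ht
  have hm := ht.two_le
  have hVpos := U_pos ht N
  have hN1 := U_strictMono ht (Nat.lt_succ_self N)
  simp only [Nat.succ_eq_add_one] at hN1
  obtain ⟨a, ha⟩ : ∃ a, a + t m * U m t N = U m t (N + m) := by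
    have := (suffix_word hk N).length_le
    rw [List.length_append, length_wpow, length_word, length_word, length_word] at this
    exact ⟨U m t (N + m) - t m * U m t N, by omega⟩
  have hL := length_coreWord_succ (m := m) (t := t) N
  have hLU := U_le_length_coreWord_add_one (m := m) (t := t) (N + 1)
  rw [h1m] at hL
  rw [Z_eq (by omega), Nat.add_sub_cancel, h1m, Nat.sub_self, Nat.zero_mul] at hZ
  rw [S_eq (by omega), Nat.add_sub_cancel, h1m, Nat.sub_self, Nat.zero_add, Nat.one_mul] at hS
  have hle := Nat.le_mul_of_pos_left (U m t N) ht.one_le_last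
  have hp : U m t (N + m) - (t m - 1) * U m t N - 1 = a + U m t N - 1 := by
    rw [Nat.sub_mul, Nat.one_mul]
    omega
  rw [hp]
  refine h.exchange (e := U m t N - 1) (by omega) ?_ (Finset.subset_insert _ _) ?_ ?_
  · intro p hp
    rcases Finset.mem_insert.1 hp with rfl | hp
    · omega
    · have h1 := lt_U_of_mem_Gam ht (Finset.mem_of_mem_erase hp)
      have h2 := U_mono ht (show N + m - 1 ≤ N + m by omega)
      omega
  · intro i d h1 h2 h3 h4
    have h5 := h4 (U m t (N + 1) - 1) (U_sub_one_mem_Gam (by omega) (by omega)) (by omega)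
      (by omega)
    refine Hits.congr (i := a + i) (Hits.self (p := a + U m t N - 1) (by omega)
      (Finset.mem_insert_self _ _) (by omega) (by omega)) fun r hr => ?_
    rw [Nat.add_assoc, apply_mod_of_suffix ht hu hk ha (by omega),
      apply_mod_U ht hu (n := N) (x := i + r) (by omega)]
  · intro i d hd h1 h2
    rcases le_or_gt i (a + U m t N - 1) with hi | hi
    · exact Or.inl (Hits.self h1 (Finset.mem_insert_self _ _) hi (by omega))
    obtain ⟨x, rfl⟩ := Nat.exists_eq_add_of_le (show a ≤ i by omega)
    have hmod := Nat.mod_le x (U m t N)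
    have hlt := Nat.mod_lt x hVpos
    rcases lt_or_ge (x % U m t N + d) (U m t N) with h3 | h3
    · have := U_mono ht (show N ≤ N + m by omega)
      refine Or.inr ⟨x % U m t N, by omega, fun r hr => ?_⟩
      rw [Nat.add_assoc a, apply_mod_of_suffix ht hu hk ha (by omega), ← Nat.mod_add_mod,
        Nat.mod_eq_of_lt (show x % U m t N + r < U m t N by omega)]
    · refine Or.inl (Hits.congr (i := a + x % U m t N) (Hits.self (p := a + U m t N - 1) (by omega)
        (Finset.mem_insert_self _ _) (by omega) (by omega)) fun r hr => ?_)
      rw [Nat.add_assoc a, Nat.add_assoc a, apply_mod_of_suffix ht hu hk ha (by omega),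
        apply_mod_of_suffix ht hu hk ha (by omega), Nat.mod_add_mod]

/-- If the end of the prefix, from the start `q` of the suffix `u_{n-m+k} u_{n-m}^{t_m}` of `u_n`
on (where `n = N + m`), begins with `u_{n-m+k+1}`, up to the last letter of this word if it occurs
only there, then the position `U_{n-m+k} - 1` can be replaced by its copy in this end. -/
theorem prefixAttractor_of_ge {k q : ℕ}
    (hk : IsLeast {j : ℕ | 1 ≤ j ∧ j ≤ m - 1 ∧ t (m - j) ≠ 0} k)
    (hq : q + U m t (N + k) + t m * U m t N = U m t (N + m)) (hU : U m t (N + m) ≤ l)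
    (hZ : l ≤ Z m t (N + m)) (hl : q + (coreWord m t (N + k + 1)).length ≤ l)
    (hs : ∀ x < (coreWord m t (N + k + 1)).length, u (q + x) = u x) :
    PrefixAttractor u l (insert (U m t (N + m) - t m * U m t N - 1)
      ((Gam m t (N + m - 1)).erase (U m t (N + k) - 1))) := by
  have hm := ht.two_le
  have hk1 := hk.1.1
  have hk2 := hk.1.2.1
  have htm := t_last_le_first ht
  have hVpos := U_pos ht (N + k)
  have hle := Nat.le_mul_of_pos_left (U m t N) ht.one_le_last
  have hVpos' := U_pos ht N
  have hNk := U_strictMono ht (show N + k < N + k + 1 by omega)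
  have hL := length_coreWord_succ (m := m) (t := t) N
  have hLU := length_coreWord_le (m := m) (t := t) (N + 1)
  have hUm := U_mono ht (show N + 1 ≤ N + m by omega)
  rw [Z_eq (by omega), Nat.add_sub_cancel, Nat.sub_mul] at hZ
  have hmul : t m * U m t N ≤ t 1 * U m t N := Nat.mul_le_mul_right _ htm
  have hp : U m t (N + m) - t m * U m t N - 1 = q + U m t (N + k) - 1 := by omega
  rw [hp]
  refine h.exchange (e := U m t (N + k) - 1) hU ?_ (Finset.subset_insert _ _) ?_ ?_
  · intro p hp
    rcases Finset.mem_insert.1 hp with rfl | hp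
    · omega
    · have h1 := lt_U_of_mem_Gam ht (Finset.mem_of_mem_erase hp)
      have h2 := U_mono ht (show N + m - 1 ≤ N + m by omega)
      omega
  · intro i d h1 h2 h3 h4
    have h5 : i + d ≤ (coreWord m t (N + k + 1)).length := by
      rcases lt_or_ge (k + 1) m with hkm | hkm
      · have h5 := h4 (U m t (N + k + 1) - 1) (U_sub_one_mem_Gam (by omega) (by omega)) (by omega)
          (by omega)
        have := U_le_length_coreWord_add_one (m := m) (t := t) (N + k + 1)
        omega
      · rw [length_coreWord_of_le (by omega), show N + k + 1 = N + m by omega]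
        exact h1
    refine Hits.congr (i := q + i) (Hits.self (p := q + U m t (N + k) - 1) (by omega)
      (Finset.mem_insert_self _ _) (by omega) (by omega)) fun r hr => ?_
    rw [Nat.add_assoc, hs _ (by omega)]
  · intro i d hd h1 h2
    rcases le_or_gt i (q + U m t (N + k) - 1) with hi | hi
    · exact Or.inl (Hits.self h1 (Finset.mem_insert_self _ _) hi (by omega))
    obtain ⟨x, rfl⟩ := Nat.exists_eq_add_of_le (show q + U m t (N + k) ≤ i by omega)
    refine Or.inr ⟨x, by omega, fun r hr => ?_⟩
    rw [Nat.add_assoc (q + _), apply_mod_of_suffix ht hu hk hq (by omega),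
      ← apply_mod_U ht hu (by omega)]

end Steps

/-! ### Attractors with as many elements as letters -/

section Main

variable {m : ℕ} [NeZero m] {t : ℕ → ℕ} (ht : IsSimpleParry m t)
  {u : ℕ → Fin m} (hu : IsFixedPoint (morphism m t) u)
include ht hu

/-- The word `u_n` with `n ≥ m` keeps an attractor of `m` positions. -/
theorem prefixAttractor_U (N : ℕ) : PrefixAttractor u (U m t (N + m)) (Gam m t (N + m - 1)) := by
  have hm := ht.two_le
  induction N with
  | zero =>
    refine prefixAttractor_Gam_small ht hu (0 + m - 1) (by omega) _ (U_mono ht (by omega)) ?_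
    rw [show 0 + m - 1 + 1 = 0 + m by omega, length_coreWord_of_le (by omega)]
  | succ N ih =>
    have h1 := Z_le_S (t := t) (show m ≤ N + m by omega)
    have h2 := S_le ht (show m ≤ N + m by omega)
    have h3 := U_add_le ht (N := N + 1) (n := N + m) (by omega)
    have h4 := U_mono ht (show N ≤ N + 1 by omega)
    rw [show N + 1 + m - 1 = N + m by omega, show N + 1 + m = N + m + 1 by omega]
    exact prefixAttractor_Gam ht ih hu (h1.trans h2) (by omega) le_rfl

/-- The end of the prefix from the start `q` of the suffix `u_{n-m+k} u_{n-m}^{t_m}` of `u_n` on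
(where `n = N + m`) agrees with `u_{n-m+k+1}`, up to the last letter of this word if it occurs
only there. -/
theorem apply_add_of_suffix {N k q x : ℕ}
    (hk : IsLeast {j : ℕ | 1 ≤ j ∧ j ≤ m - 1 ∧ t (m - j) ≠ 0} k)
    (hq : q + U m t (N + k) + t m * U m t N = U m t (N + m))
    (hx : q + x < Z m t (N + m)) (hx' : x < (coreWord m t (N + k + 1)).length) :
    u (q + x) = u x := by
  have hL := length_coreWord_succ (m := m) (t := t) N
  rw [Z_eq (by omega), Nat.add_sub_cancel, Nat.sub_mul] at hx
  have hmul : t m * U m t N ≤ t 1 * U m t N := Nat.mul_le_mul_right _ (t_last_le_first ht)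
  rcases lt_or_ge x (U m t (N + k)) with h | h
  · obtain ⟨y, hy⟩ := suffix_word hk N
    have hl := congrArg List.length hy
    rw [List.length_append, List.length_append, length_wpow, length_word, length_word,
      length_word] at hl
    have h2 := occursAt_word ht hu (N + m)
    rw [← hy, occursAt_append, occursAt_append, Nat.zero_add] at h2
    rw [show q = y.length by omega, h2.2.1.eq_shift (occursAt_word ht hu (N + k)) h, Nat.zero_add]
  · obtain ⟨r, rfl⟩ := Nat.exists_eq_add_of_le h
    rw [apply_U_add ht hu hx', ← Nat.add_assoc, apply_mod_of_suffix ht hu hk hq (by omega),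
      ← apply_mod_U ht hu (by omega)]

theorem prefix_or_prefix_and_attractors {k n l : ℕ}
    (hk : IsLeast {j : ℕ | 1 ≤ j ∧ j ≤ m - 1 ∧ t (m - j) ≠ 0} k) (hn : m ≤ n)
    (hU : U m t n ≤ l) (hZ : l ≤ Z m t n) :
    ∃ x : List (Fin m), pref u l = word m t n ++ x ∧
      (word m t (n - m + k) ++ wpow (word m t (n - m)) (t m) ++ x <+: word m t (n - m + k + 1) ∨
        coreWord m t (n - m + k + 1) <+:
          word m t (n - m + k) ++ wpow (word m t (n - m)) (t m) ++ x) ∧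
      (word m t (n - m + k) ++ wpow (word m t (n - m)) (t m) ++ x <+: word m t (n - m + k + 1) →
        IsLetterSizeAttractor (pref u l)
          (insert (U m t n - U m t (n - m + k) - (t m - 1) * U m t (n - m) - 1)
            ((Gam m t (n - 1)).erase (U m t (n - m) - 1)))) ∧
      (coreWord m t (n - m + k + 1) <+:
          word m t (n - m + k) ++ wpow (word m t (n - m)) (t m) ++ x →
        IsLetterSizeAttractor (pref u l)
          (insert (U m t n - t m * U m t (n - m) - 1)
            ((Gam m t (n - 1)).erase (U m t (n - m + k) - 1)))) := by
  obtain ⟨N, rfl⟩ := Nat.exists_eq_add_of_le' hn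
  rw [Nat.add_sub_cancel]
  have hm := ht.two_le
  have hk1 := hk.1.1
  have hk2 := hk.1.2.1
  have hcore : OccursAt u 0 (coreWord m t (N + k + 1)) := by
    refine (occursAt_word ht hu (N + k + 1)).of_prefix ?_
    rw [word_eq_coreWord_append]
    exact List.prefix_append _ _
  obtain ⟨x, hx⟩ : word m t (N + m) <+: pref u l := by
    rw [← pref_U ht hu]
    exact pref_prefix_pref u hU
  obtain ⟨y, hy⟩ := suffix_word hk N
  have hq := congrArg List.length hy
  rw [List.length_append, List.length_append, length_wpow, length_word, length_word,
    length_word, ← Nat.add_assoc] at hq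
  have hlx := congrArg List.length hx
  rw [List.length_append, length_word, length_pref] at hlx
  have hocc := occursAt_pref u l
  rw [← hx, ← hy, List.append_assoc, occursAt_append, Nat.zero_add] at hocc
  have hY := hocc.2
  obtain ⟨Y, hYdef⟩ : ∃ Y, Y = word m t (N + k) ++ wpow (word m t N) (t m) ++ x := ⟨_, rfl⟩
  rw [← hYdef] at hY
  have hYlen : y.length + Y.length = l := by
    rw [hYdef, List.length_append, List.length_append, length_wpow, length_word, length_word]
    omega
  have hU1 := U_mono ht (show N + m - 1 ≤ N + m by omega)
  refine ⟨x, hx.symm, ?_⟩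
  rw [← hYdef]
  refine ⟨?_, fun hpre => ?_, fun hpre => ?_⟩
  · -- both words are prefixes of a common sequence, so the shorter one is a prefix of the longer
    have hagree : ∀ r, r < Y.length → r < (coreWord m t (N + k + 1)).length →
        u (y.length + r) = u r := fun r h1 h2 =>
      apply_add_of_suffix ht hu hk hq (by omega) h2
    have hYeq : pref (fun r => u (y.length + r)) Y.length = Y := hY
    rw [← hYeq]
    rcases le_total Y.length (coreWord m t (N + k + 1)).length with hle | hle
    · left
      rw [pref_congr (fun r hr => hagree r hr (by omega)), word_eq_coreWord_append]
      refine List.IsPrefix.trans ?_ (List.prefix_append _ _)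
      rw [← occursAt_zero.1 hcore]
      exact pref_prefix_pref u hle
    · right
      rw [← occursAt_zero.1 hcore, ← pref_congr (fun r hr => hagree r (by omega) hr)]
      exact pref_prefix_pref _ hle
  · refine isLetterSizeAttractor_of_card_le ht hu (n := N + m - 1) (by omega) (by omega) ?_
      (card_insert_erase_Gam_le (by omega) (by omega))
    refine prefixAttractor_of_le ht (prefixAttractor_U ht hu N) hk hq hU ?_ fun r hr => ?_
    · have := hpre.length_le
      rw [length_word] at this
      omega
    · have := hY.eq_shift ((occursAt_word ht hu _).of_prefix hpre) (show r < Y.length by omega)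
      rwa [Nat.zero_add] at this
  · refine isLetterSizeAttractor_of_card_le ht hu (n := N + m - 1) (by omega) (by omega) ?_
      (card_insert_erase_Gam_le (by omega) (by omega))
    refine prefixAttractor_of_ge ht (prefixAttractor_U ht hu N) hu hk hq hU hZ ?_ fun r hr => ?_
    · have := hpre.length_le
      omega
    · have := (hY.of_prefix hpre).eq_shift hcore hr
      rwa [Nat.zero_add] at this

theorem isLetterSizeAttractor_small {n l : ℕ} (hn : n < m) (h1 : U m t n ≤ l)
    (h2 : l ≤ (coreWord m t (n + 1)).length) : IsLetterSizeAttractor (pref u l) (Gam m t n) :=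
  (prefixAttractor_Gam_small ht hu n hn l h1 h2).isLetterSizeAttractor
    ((card_Gam_le n).trans (le_card_toFinset_pref ht hu h1))

theorem isLetterSizeAttractor_Gam {n l : ℕ} (hn : m ≤ n) (hZ : Z m t n ≤ l)
    (hV : U m t n + U m t (n - m) ≤ l) (hl : l ≤ U m t (n + 1)) :
    IsLetterSizeAttractor (pref u l) (Gam m t n) := by
  obtain ⟨N, rfl⟩ := Nat.exists_eq_add_of_le' hn
  rw [Nat.add_sub_cancel] at hV
  exact isLetterSizeAttractor_of_card_le ht hu (n := N + m) (by omega) (by omega)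
    (prefixAttractor_Gam ht (prefixAttractor_U ht hu N) hu hZ hV hl)
    ((card_Gam_le _).trans (min_le_right _ _))

theorem isLetterSizeAttractor_of_lt (h : t m < t 1) {n l : ℕ} (hn : m ≤ n) (hZ : Z m t n ≤ l)
    (hl : l ≤ U m t (n + 1)) : IsLetterSizeAttractor (pref u l) (Gam m t n) := by
  refine isLetterSizeAttractor_Gam ht hu hn hZ ?_ hl
  have := Nat.le_mul_of_pos_left (U m t (n - m)) (Nat.sub_pos_of_lt h)
  rw [Z_eq hn] at hZ
  omega

theorem isLetterSizeAttractor_of_S_le {n l : ℕ} (hn : m ≤ n)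
    (hS : S m t n ≤ l) (hl : l ≤ U m t (n + 1)) :
    IsLetterSizeAttractor (pref u l) (Gam m t n) := by
  refine isLetterSizeAttractor_Gam ht hu hn ((Z_le_S hn).trans hS) ?_ hl
  rw [S_eq hn, Nat.succ_mul] at hS
  omega

theorem isLetterSizeAttractor_of_le_S (h : t 1 = t m) {n l : ℕ} (hn : m ≤ n) (hZ : Z m t n ≤ l)
    (hS : l ≤ S m t n) : IsLetterSizeAttractor (pref u l)
      (insert (U m t n - (t m - 1) * U m t (n - m) - 1)
        ((Gam m t (n - 1)).erase (U m t (n - m) - 1))) := by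
  obtain ⟨N, rfl⟩ := Nat.exists_eq_add_of_le' hn
  have hm := ht.two_le
  rw [Nat.add_sub_cancel]
  refine isLetterSizeAttractor_of_card_le ht hu (n := N + m) (by omega) ?_
    (prefixAttractor_of_first_eq_last ht (prefixAttractor_U ht hu N) hu h hZ hS)
    (card_insert_erase_Gam_le (by omega) (by omega))
  rw [Z_eq hn] at hZ
  omega

theorem exists_isLetterSizeAttractor (l : ℕ) :
    ∃ Γ : Finset ℕ, IsLetterSizeAttractor (pref u l) Γ := by
  rcases Nat.eq_zero_or_pos l with rfl | hl
  · refine ⟨∅, PrefixAttractor.isLetterSizeAttractor ⟨by simp, fun i d h1 h2 => by omega⟩ (by simp)⟩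
  obtain ⟨n, h1, h2⟩ : ∃ n, U m t n ≤ l ∧ l < U m t (n + 1) := by
    have hex : ∃ n, l < U m t n := ⟨l + 1, (U_strictMono ht).le_apply⟩
    classical
    have hspec := Nat.find_spec hex
    have hmin := fun n => Nat.find_min hex (m := n)
    generalize Nat.find hex = n at hspec hmin
    cases n with
    | zero => exact absurd hspec (by simp [U, word]; omega)
    | succ n => exact ⟨n, not_lt.1 (hmin n (Nat.lt_succ_self n)), hspec⟩
  rcases lt_or_ge n m with hn | hn
  · have := U_le_length_coreWord_add_one (m := m) (t := t) (n + 1)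
    exact ⟨_, isLetterSizeAttractor_small ht hu hn h1 (by omega)⟩
  rcases le_total l (Z m t n) with hZ | hZ
  · obtain ⟨k, hk⟩ := exists_isLeast_parameter ht
    obtain ⟨x, _, h3 | h3, h4, h5⟩ := prefix_or_prefix_and_attractors ht hu hk hn h1 hZ
    · exact ⟨_, h4 h3⟩
    · exact ⟨_, h5 h3⟩
  rcases (t_last_le_first ht).lt_or_eq with h | h
  · exact ⟨_, isLetterSizeAttractor_of_lt ht hu h hn hZ h2.le⟩
  rcases le_total l (S m t n) with hS | hS
  · exact ⟨_, isLetterSizeAttractor_of_le_S ht hu h.symm hn hZ hS⟩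
  · exact ⟨_, isLetterSizeAttractor_of_S_le ht hu hn hS h2.le⟩

end Main

end SimpleParry

theorem mainTheorem1 (m : ℕ) [NeZero m] (t : ℕ → ℕ) (ht : SimpleParry.IsSimpleParry m t)
    (u : ℕ → Fin m) (hu : SimpleParry.IsFixedPoint (SimpleParry.morphism m t) u) :
    -- every prefix has a minimal attractor whose size is its number of distinct letters
    (∀ l : ℕ, ∃ Γ : Finset ℕ, SimpleParry.IsLetterSizeAttractor (SimpleParry.pref u l) Γ) ∧
    -- explicit attractors
    (∀ n l : ℕ, n ≤ m - 1 → SimpleParry.U m t n ≤ l → l ≤ SimpleParry.U m t (n + 1) - 1 →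
      SimpleParry.IsLetterSizeAttractor (SimpleParry.pref u l) (SimpleParry.Gam m t n)) ∧
    (SimpleParry.pref u (SimpleParry.U m t m) = SimpleParry.word m t m ∧
      SimpleParry.IsLetterSizeAttractor (SimpleParry.word m t m) (SimpleParry.Gam m t (m - 1))) ∧
    (t m < t 1 → ∀ n l : ℕ, m ≤ n → SimpleParry.Z m t n ≤ l → l ≤ SimpleParry.U m t (n + 1) →
      SimpleParry.IsLetterSizeAttractor (SimpleParry.pref u l) (SimpleParry.Gam m t n)) ∧
    (t 1 = t m → ∀ n l : ℕ, m ≤ n → SimpleParry.Z m t n ≤ l → l ≤ SimpleParry.S m t n →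
      SimpleParry.IsLetterSizeAttractor (SimpleParry.pref u l)
        (insert (SimpleParry.U m t n - (t m - 1) * SimpleParry.U m t (n - m) - 1)
          ((SimpleParry.Gam m t (n - 1)).erase (SimpleParry.U m t (n - m) - 1)))) ∧
    (t 1 = t m → ∀ n l : ℕ, m ≤ n → SimpleParry.S m t n ≤ l → l ≤ SimpleParry.U m t (n + 1) →
      SimpleParry.IsLetterSizeAttractor (SimpleParry.pref u l) (SimpleParry.Gam m t n)) ∧
    (∀ k : ℕ, IsLeast {j : ℕ | 1 ≤ j ∧ j ≤ m - 1 ∧ t (m - j) ≠ 0} k →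
      ∀ n l : ℕ, m ≤ n → SimpleParry.U m t n ≤ l → l ≤ SimpleParry.Z m t n →
        ∃ x : List (Fin m), SimpleParry.pref u l = SimpleParry.word m t n ++ x ∧
          -- at least one of the two categories occurs
          (SimpleParry.word m t (n - m + k) ++ SimpleParry.wpow (SimpleParry.word m t (n - m)) (t m)
                ++ x <+: SimpleParry.word m t (n - m + k + 1) ∨
            SimpleParry.coreWord m t (n - m + k + 1) <+:
              SimpleParry.word m t (n - m + k) ++
                SimpleParry.wpow (SimpleParry.word m t (n - m)) (t m) ++ x) ∧
          -- the attractor in the first category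
          (SimpleParry.word m t (n - m + k) ++ SimpleParry.wpow (SimpleParry.word m t (n - m)) (t m)
                ++ x <+: SimpleParry.word m t (n - m + k + 1) →
            SimpleParry.IsLetterSizeAttractor (SimpleParry.pref u l)
              (insert
                (SimpleParry.U m t n - SimpleParry.U m t (n - m + k)
                  - (t m - 1) * SimpleParry.U m t (n - m) - 1)
                ((SimpleParry.Gam m t (n - 1)).erase (SimpleParry.U m t (n - m) - 1)))) ∧
          -- the attractor in the second category
          (SimpleParry.coreWord m t (n - m + k + 1) <+:
              SimpleParry.word m t (n - m + k) ++
                SimpleParry.wpow (SimpleParry.word m t (n - m)) (t m) ++ x →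
            SimpleParry.IsLetterSizeAttractor (SimpleParry.pref u l)
              (insert (SimpleParry.U m t n - t m * SimpleParry.U m t (n - m) - 1)
                ((SimpleParry.Gam m t (n - 1)).erase (SimpleParry.U m t (n - m + k) - 1))))) := by
  have hm := ht.two_le
  refine ⟨SimpleParry.exists_isLetterSizeAttractor ht hu, fun n l hn h1 h2 => ?_,
    ⟨SimpleParry.pref_U ht hu m, ?_⟩,
    fun h n l hn hZ hl => SimpleParry.isLetterSizeAttractor_of_lt ht hu h hn hZ hl,
    fun h n l hn hZ hS => SimpleParry.isLetterSizeAttractor_of_le_S ht hu h hn hZ hS,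
    fun _ n l hn hS hl => SimpleParry.isLetterSizeAttractor_of_S_le ht hu hn hS hl,
    fun k hk n l hn hU hZ => SimpleParry.prefix_or_prefix_and_attractors ht hu hk hn hU hZ⟩
  · have := SimpleParry.U_le_length_coreWord_add_one (m := m) (t := t) (n + 1)
    exact SimpleParry.isLetterSizeAttractor_small ht hu (by omega) h1 (by omega)
  · rw [← SimpleParry.pref_U ht hu]
    refine SimpleParry.isLetterSizeAttractor_small ht hu (by omega)
      (SimpleParry.U_mono ht (by omega)) ?_
    rw [show m - 1 + 1 = m by omega, SimpleParry.length_coreWord_of_le le_rfl]
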